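/- Let $C_{aa}$ be the set of almost automorphic functions, i.e. continuous $f:\mathbb R\to\mathbb C$ such that every real sequence $(s_m)$ has a subsequence $(s_{m_k})$ and a function $g:\mathbb R\to\mathbb C$ with $g(x)=\lim_k f(x+s_{m_k})$ and $f(x)=\lim_k g(x-s_{m_k})$ for every $x\in\mathbb R$. Let $\mathcal D$ be the space of smooth compactly supported functions $\mathbb R\to\mathbb C$ and let $\mathcal D_{L^1}$ be the space of smooth functions $\varphi:\mathbb R\to\mathbb C$ with $\varphi^{(i)}\in L^1$ for all $i\ge 0$, with the topology given by the norms $\sum_{i\le m}\|\varphi^{(i)}\|_{L^1}$, $m\ge 0$. A distribution on $\mathbb R$ is called bounded if it belongs to $\mathcal D'_{L^\infty}$, i.e. it is the restriction to $\mathcal D$ of a continuous linear functional on $\mathcal D_{L^1}$. A bounded distribution $T$ is called almost automorphic, $T\in\mathcal B'_{aa}$, if $T*\varphi\in C_{aa}$ for every $\varphi\in\mathcal D$, where $(T*\varphi)(x)=\langle T,\varphi(x-\cdot)\rangle$. Let $p\ge 0$ be an integer, $a_0,\dots,a_p\in\mathbb C$ and $L=\sum_{i=0}^p a_i\frac{d^i}{dx^i}$.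 If no root $\lambda\in\mathbb C$ of the polynomial $\sum_{i=0}^p a_i\lambda^i$ has real part zero, then for every $S\in\mathcal B'_{aa}$, every bounded distribution $T\in\mathcal D'_{L^\infty}$ with $LT=S$ in the sense of distributions is almost automorphic, i.e. $T\in\mathcal B'_{aa}$. -/

import Mathlib

open TopologicalSpace MeasureTheory Filter Topology
open scoped Distributions LineDeriv ContDiff

/-! ### Almost automorphic functions -/

/-- Bochner almost automorphic functions `ℝ → ℂ`: continuous functions such that every real sequence
`s` has a subsequence along which `f (x + s)` converges pointwise to some function `g` and
`g (x - s)` converges pointwise back to `f`. -/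
def IsAlmostAutomorphic (f : ℝ → ℂ) : Prop :=
  Continuous f ∧ ∀ s : ℕ → ℝ, ∃ κ : ℕ → ℕ, StrictMono κ ∧ ∃ g : ℝ → ℂ,
    (∀ x, Tendsto (fun k => f (x + s (κ k))) atTop (𝓝 (g x))) ∧
    (∀ x, Tendsto (fun k => g (x - s (κ k))) atTop (𝓝 (f x)))

/-! ### The Fréchet space `𝒟_{L¹}` -/

/-- The smooth functions `ℝ → ℂ` all of whose derivatives (of order `0, 1, 2, …`) are
Lebesgue integrable. -/
def dL1Submodule : Submodule ℂ (ℝ → ℂ) where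
  carrier := {f | ContDiff ℝ ∞ f ∧ ∀ i : ℕ, Integrable (iteratedDeriv i f)}
  zero_mem' := ⟨contDiff_const, fun i => by
    rw [show iteratedDeriv i (0 : ℝ → ℂ) = 0 from
      funext fun _ => iteratedDeriv_const_zero]
    exact integrable_zero _ _ _⟩
  add_mem' := by
    rintro f g ⟨hf, hf'⟩ ⟨hg, hg'⟩
    refine ⟨hf.add hg, fun i => ?_⟩
    have : iteratedDeriv i (f + g) = iteratedDeriv i f + iteratedDeriv i g := by
      funext x
      exact iteratedDeriv_add (hf.contDiffAt.of_le (mod_cast le_top))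
        (hg.contDiffAt.of_le (mod_cast le_top))
    rw [this]
    exact (hf' i).add (hg' i)
  smul_mem' := by
    rintro c f ⟨hf, hf'⟩
    refine ⟨hf.const_smul c, fun i => ?_⟩
    have : iteratedDeriv i (c • f) = c • iteratedDeriv i f := by
      funext x
      exact iteratedDeriv_const_smul_field c f
    rw [this]
    exact (hf' i).smul c

/-- The space `𝒟_{L¹}`. It is a type of its own so that it carries the Fréchet topology below rather
than the topology of pointwise convergence. -/
def DL1 : Type := dL1Submodule

namespace DL1

noncomputable instance : AddCommGroup DL1 := inferInstanceAs (AddCommGroup dL1Submodule)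

noncomputable instance : Module ℂ DL1 := inferInstanceAs (Module ℂ dL1Submodule)

instance : CoeFun DL1 (fun _ => ℝ → ℂ) := ⟨fun f => f.1⟩

/-- The norm `|φ|_{m,1} = ∑_{i ≤ m} ‖φ^{(i)}‖_{L¹}`. -/
noncomputable def seminorm (m : ℕ) : Seminorm ℂ DL1 :=
  Seminorm.of (fun f => ∑ i ∈ Finset.range (m + 1), ∫ x, ‖iteratedDeriv i f x‖)
    (by
      rintro ⟨f, hf, hf'⟩ ⟨g, hg, hg'⟩
      rw [← Finset.sum_add_distrib]
      refine Finset.sum_le_sum fun i _ => ?_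
      rw [← integral_add (hf' i).norm (hg' i).norm]
      have : iteratedDeriv i (f + g) = iteratedDeriv i f + iteratedDeriv i g := by
        funext x
        exact iteratedDeriv_add (hf.contDiffAt.of_le (mod_cast le_top))
          (hg.contDiffAt.of_le (mod_cast le_top))
      change ∫ x, ‖iteratedDeriv i (f + g) x‖ ≤ _
      rw [this]
      exact integral_mono ((hf' i).add (hg' i)).norm ((hf' i).norm.add (hg' i).norm)
        fun x => norm_add_le _ _)
    (by
      rintro c ⟨f, hf, hf'⟩
      rw [Finset.mul_sum]
      refine Finset.sum_congr rfl fun i _ => ?_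
      rw [← integral_const_mul]
      refine integral_congr_ae (Eventually.of_forall fun x => ?_)
      change ‖iteratedDeriv i (c • f) x‖ = ‖c‖ * ‖iteratedDeriv i f x‖
      rw [iteratedDeriv_const_smul_field c f, norm_smul])

/-- The topology of `𝒟_{L¹}`, defined by the norms `|·|_{m,1}`, `m = 0, 1, 2, …`. -/
noncomputable instance : TopologicalSpace DL1 :=
  SeminormFamily.moduleFilterBasis (𝕜 := ℂ) (fun m : ℕ => seminorm m) |>.topology

theorem withSeminorms : WithSeminorms (𝕜 := ℂ) (fun m : ℕ => seminorm m) := ⟨rfl⟩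

/-- A real test function, regarded as an element of `𝒟_{L¹}`. -/
noncomputable def ofTestFunction (φ : 𝓓((⊤ : Opens ℝ), ℝ)) : DL1 :=
  ⟨fun x => (φ x : ℂ), by
    have h : ContDiff ℝ ∞ (fun x => (φ x : ℂ)) := Complex.ofRealCLM.contDiff.comp φ.contDiff
    have hc : HasCompactSupport (fun x => (φ x : ℂ)) :=
      φ.hasCompactSupport.comp_left (g := fun r : ℝ => (r : ℂ)) Complex.ofReal_zero
    refine ⟨h, fun i => Continuous.integrable_of_hasCompactSupport
      (h.continuous_iteratedDeriv i (mod_cast le_top)) ?_⟩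
    induction i with
    | zero => simpa using hc
    | succ n ih => rw [iteratedDeriv_succ]; exact ih.deriv⟩

end DL1

/-! ### Bounded distributions and almost automorphic distributions

Complex distributions on `ℝ` are the elements of `𝓓'(⊤, ℂ)`: continuous `ℝ`-linear maps to `ℂ` on
real test functions. They act on complex test functions by complex linearity. -/

namespace Distribution

/-- `T ∈ 𝒟'_{L^∞}`: the distribution `T` is (the restriction to test functions of) an element of the
topological dual of `𝒟_{L¹}`. -/
def IsBoundedDistribution (T : 𝓓'((⊤ : Opens ℝ), ℂ)) : Prop :=
  ∃ u : DL1 →L[ℂ] ℂ, ∀ φ : 𝓓((⊤ : Opens ℝ), ℝ), T φ = u (DL1.ofTestFunction φ)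

/-- The value `⟨T, φ⟩` of a complex distribution on a complex test function. -/
noncomputable def pairing (T : 𝓓'((⊤ : Opens ℝ), ℂ)) (φ : 𝓓((⊤ : Opens ℝ), ℂ)) : ℂ :=
  T (TestFunction.postcompCLM Complex.reCLM φ) +
    Complex.I * T (TestFunction.postcompCLM Complex.imCLM φ)

/-- The test function `y ↦ φ (x - y)`. -/
noncomputable def reflectTranslate (φ : 𝓓((⊤ : Opens ℝ), ℂ)) (x : ℝ) : 𝓓((⊤ : Opens ℝ), ℂ) :=
  ⟨fun y => φ (x - y), φ.contDiff.comp (contDiff_const.sub contDiff_id),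
    φ.hasCompactSupport.comp_homeomorph (Homeomorph.subLeft x), fun _ _ => trivial⟩

/-- The convolution `(T * φ)(x) = ⟨T, φ(x - ·)⟩` of a distribution with a test function. -/
noncomputable def conv (T : 𝓓'((⊤ : Opens ℝ), ℂ)) (φ : 𝓓((⊤ : Opens ℝ), ℂ)) (x : ℝ) : ℂ :=
  pairing T (reflectTranslate φ x)

/-- `T ∈ ℬ'_{aa}`: `T` is a bounded distribution and `T * φ` is an almost automorphic function for
every test function `φ`. -/
def IsAlmostAutomorphicDistribution (T : 𝓓'((⊤ : Opens ℝ), ℂ)) : Prop :=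
  IsBoundedDistribution T ∧ ∀ φ : 𝓓((⊤ : Opens ℝ), ℂ), IsAlmostAutomorphic (conv T φ)

/-- The constant coefficient operator `L = ∑_{i=0}^p a_i dⁱ/dxⁱ`, with distributional derivatives. -/
noncomputable def diffOp (p : ℕ) (a : ℕ → ℂ) (T : 𝓓'((⊤ : Opens ℝ), ℂ)) :
    𝓓'((⊤ : Opens ℝ), ℂ) :=
  ∑ i ∈ Finset.range (p + 1), a i • (∂_{(1 : ℝ)})^[i] T

end Distribution

/-! ### Operations on almost automorphic functions -/

namespace IsAlmostAutomorphic

/-! The polynomial splits into factors `X - z` with `z` off the imaginary axis, so by induction on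
the degree it suffices to recover `T` from `T' - zT`. For a test function `φ`, the function `f = T *
φ` satisfies `f' = z f + h` with `h = (T' - zT) * φ`. Both `f` and `h` are bounded because the
distributions are, and `h` is almost automorphic.

Boundedness of `f` excludes the homogeneous solutions: for `0 < re z`, `f x = -∫₀^∞ e^{-zt} h (x +
t) dt` (`eq_neg_integral_of_hasDerivAt`), and reflection covers `re z < 0`. Averaging translates of
`h` against an integrable kernel preserves almost automorphy by dominated convergence
(`integral_mul_translate`). The distributional input is `exists_norm_conv_le` and `hasDerivAt_conv`.
-/

theorem const_mul {f : ℝ → ℂ} (hf : IsAlmostAutomorphic f) (c : ℂ) :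
    IsAlmostAutomorphic fun x => c * f x := by
  refine ⟨continuous_const.mul hf.1, fun s => ?_⟩
  obtain ⟨κ, hκ, g, hg, hg'⟩ := hf.2 s
  exact ⟨κ, hκ, fun x => c * g x, fun x => (hg x).const_mul c, fun x => (hg' x).const_mul c⟩

theorem comp_neg {f : ℝ → ℂ} (hf : IsAlmostAutomorphic f) :
    IsAlmostAutomorphic fun x => f (-x) := by
  refine ⟨hf.1.comp continuous_neg, fun s => ?_⟩
  obtain ⟨κ, hκ, g, hg, hg'⟩ := hf.2 fun n => -s n
  refine ⟨κ, hκ, fun x => g (-x), fun x => ?_, fun x => ?_⟩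
  · simpa only [neg_add] using hg (-x)
  · simpa only [neg_sub, sub_neg_eq_add, neg_add_eq_sub] using hg' (-x)

/-- Averages of the translates of a bounded almost automorphic function against an integrable kernel
are almost automorphic. -/
theorem integral_mul_translate {h : ℝ → ℂ} (hh : IsAlmostAutomorphic h) {C : ℝ}
    (hC : ∀ x, ‖h x‖ ≤ C) {μ : Measure ℝ} {k : ℝ → ℂ} (hk : Integrable k μ) :
    IsAlmostAutomorphic fun x => ∫ t, k t * h (x + t) ∂μ := by
  have bound : ∀ {w : ℝ → ℂ}, (∀ x, ‖w x‖ ≤ C) → ∀ x t, ‖k t * w (x + t)‖ ≤ ‖k t‖ * C :=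
    fun hw x t => by
      rw [norm_mul]
      exact mul_le_mul_of_nonneg_left (hw _) (norm_nonneg _)
  have meas : ∀ {w : ℝ → ℂ}, Measurable w → ∀ x,
      AEStronglyMeasurable (fun t => k t * w (x + t)) μ := fun hw x =>
    hk.aestronglyMeasurable.mul (hw.comp (measurable_const_add x)).aestronglyMeasurable
  refine ⟨continuous_of_dominated (meas hh.1.measurable)
    (fun x => Eventually.of_forall (bound hC x)) (hk.norm.mul_const C)
    (Eventually.of_forall fun t => ?_), fun s => ?_⟩
  · exact continuous_const.mul (hh.1.comp (continuous_id.add continuous_const))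
  obtain ⟨κ, hκ, g, hg, hg'⟩ := hh.2 s
  -- The limit `g` need not be continuous; measurability and the bound `C` are all that the return
  -- limit needs.
  have hgm : Measurable g := measurable_of_tendsto_metrizable
    (fun n => (hh.1.comp (continuous_add_const (s (κ n)))).measurable) (tendsto_pi_nhds.2 hg)
  have hgC : ∀ x, ‖g x‖ ≤ C := fun x => le_of_tendsto' (hg x).norm fun _ => hC _
  refine ⟨κ, hκ, fun x => ∫ t, k t * g (x + t) ∂μ, fun x => ?_, fun x => ?_⟩
  · refine tendsto_integral_of_dominated_convergence (fun t => ‖k t‖ * C)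
      (fun n => meas hh.1.measurable _) (hk.norm.mul_const C)
      (fun n => Eventually.of_forall (bound hC _)) (Eventually.of_forall fun t => ?_)
    simpa only [add_right_comm] using (hg (x + t)).const_mul (k t)
  · refine tendsto_integral_of_dominated_convergence (fun t => ‖k t‖ * C)
      (fun n => meas hgm _) (hk.norm.mul_const C)
      (fun n => Eventually.of_forall (bound hgC _)) (Eventually.of_forall fun t => ?_)
    simpa only [sub_add_eq_add_sub] using (hg' (x + t)).const_mul (k t)

/-- A bounded solution of `f' = z f + h` with `0 < re z` is the integral of the translates of `h`
against the one-sided exponential kernel. -/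
theorem eq_neg_integral_of_hasDerivAt {f h : ℝ → ℂ} {z : ℂ} (hz : 0 < z.re)
    (hf : ∀ x, HasDerivAt f (z * f x + h x) x) {B C : ℝ} (hB : ∀ x, ‖f x‖ ≤ B)
    (hh : Continuous h) (hC : ∀ x, ‖h x‖ ≤ C) (x : ℝ) :
    f x = -∫ t in Set.Ioi (0 : ℝ), Complex.exp (-z * t) * h (x + t) := by
  have hexp : IntegrableOn (fun t : ℝ => Complex.exp (-z * t)) (Set.Ioi 0) :=
    integrableOn_exp_mul_complex_Ioi (by simpa using hz) 0
  have hexp_d : ∀ t : ℝ, HasDerivAt (fun t : ℝ => Complex.exp (-z * t))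
      (Complex.exp (-z * t) * -z) t := fun t => by
    simpa using ((hasDerivAt_id (t : ℂ)).const_mul (-z)).cexp.comp_ofReal
  have hderiv : ∀ t : ℝ, HasDerivAt (fun t : ℝ => Complex.exp (-z * t) * f (x + t))
      (Complex.exp (-z * t) * h (x + t)) t := fun t => by
    have h2 : HasDerivAt (fun t => f (x + t)) (z * f (x + t) + h (x + t)) t :=
      (hf (x + t)).comp_const_add x t
    refine ((hexp_d t).mul h2).congr_deriv ?_
    ring
  have hint : IntegrableOn (fun t : ℝ => Complex.exp (-z * t) * h (x + t)) (Set.Ioi 0) :=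
    hexp.mul_bdd (c := C) (hh.comp (continuous_const_add x)).aestronglyMeasurable
      (Eventually.of_forall fun t => hC _)
  have hnorm : ∀ t : ℝ, ‖Complex.exp (-z * t)‖ = Real.exp (-(z.re * t)) := fun t => by
    simp [Complex.norm_exp]
  -- Boundedness of `f` and `0 < re z` kill the boundary term at infinity, so only the value `f x`
  -- at `t = 0` survives.
  have hlim : Tendsto (fun t : ℝ => Complex.exp (-z * t) * f (x + t)) atTop (𝓝 0) := by
    refine squeeze_zero_norm (a := fun t => Real.exp (-(z.re * t)) * B) (fun t => ?_) ?_
    · rw [norm_mul, hnorm]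
      exact mul_le_mul_of_nonneg_left (hB _) (Real.exp_nonneg _)
    · simpa using (Real.tendsto_exp_neg_atTop_nhds_zero.comp
        (tendsto_id.const_mul_atTop hz)).mul_const B
  rw [integral_Ioi_of_hasDerivAt_of_tendsto' (fun t _ => hderiv t) hint hlim]
  simp

theorem of_hasDerivAt_of_re_pos {f h : ℝ → ℂ} {z : ℂ} (hz : 0 < z.re)
    (hf : ∀ x, HasDerivAt f (z * f x + h x) x) {B C : ℝ} (hB : ∀ x, ‖f x‖ ≤ B)
    (hh : IsAlmostAutomorphic h) (hC : ∀ x, ‖h x‖ ≤ C) : IsAlmostAutomorphic f := by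
  have hexp : IntegrableOn (fun t : ℝ => Complex.exp (-z * t)) (Set.Ioi 0) :=
    integrableOn_exp_mul_complex_Ioi (by simpa using hz) 0
  have key := (hh.integral_mul_translate hC hexp).const_mul (-1)
  convert key using 2 with x
  rw [neg_one_mul, eq_neg_integral_of_hasDerivAt hz hf hB hh.1 hC x]

/-- Bounded solutions of `f' = z f + h` with `h` bounded and almost automorphic are almost
automorphic, provided `z` is not purely imaginary. -/
theorem of_hasDerivAt {f h : ℝ → ℂ} {z : ℂ} (hz : z.re ≠ 0)
    (hf : ∀ x, HasDerivAt f (z * f x + h x) x) {B C : ℝ} (hB : ∀ x, ‖f x‖ ≤ B)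
    (hh : IsAlmostAutomorphic h) (hC : ∀ x, ‖h x‖ ≤ C) : IsAlmostAutomorphic f := by
  rcases hz.lt_or_gt with hneg | hpos
  -- The reflection `x ↦ f (-x)` solves the equation with `-z` in place of `z` and forcing term `-h
  -- (-x)`.
  · have key : IsAlmostAutomorphic fun x => f (-x) := by
      refine of_hasDerivAt_of_re_pos (z := -z) (h := fun x => -1 * h (-x)) (by simpa using hneg)
        (fun x => ?_) (fun x => hB (-x)) (hh.comp_neg.const_mul (-1))
        (fun x => by simpa using hC (-x))
      refine ((hf (-x)).scomp x (hasDerivAt_neg x)).congr_deriv ?_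
      rw [neg_smul, one_smul]
      ring
    simpa only [neg_neg] using key.comp_neg
  · exact of_hasDerivAt_of_re_pos hpos hf hB hh hC

end IsAlmostAutomorphic

/-! ### Differentiation and norm estimates on `𝒟_{L¹}` -/

namespace DL1

/-- A complex test function, regarded as an element of `𝒟_{L¹}`. -/
noncomputable def ofComplexTestFunction (φ : 𝓓((⊤ : Opens ℝ), ℂ)) : DL1 :=
  ⟨φ, φ.contDiff, fun i => Continuous.integrable_of_hasCompactSupport
    (φ.contDiff.continuous_iteratedDeriv i (mod_cast le_top)) <| by
      induction i with
      | zero => simpa using φ.hasCompactSupport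
      | succ n ih => rw [iteratedDeriv_succ]; exact ih.deriv⟩

theorem ext {f g : DL1} (h : ∀ x, f x = g x) : f = g :=
  Subtype.ext (funext h)

theorem seminorm_apply (m : ℕ) (f : DL1) :
    seminorm m f = ∑ i ∈ Finset.range (m + 1), ∫ x, ‖iteratedDeriv i f x‖ :=
  rfl

/-- Differentiation on `𝒟_{L¹}`. -/
noncomputable def derivLM : DL1 →ₗ[ℂ] DL1 where
  toFun f := ⟨deriv f, (contDiff_infty_iff_deriv.1 f.2.1).2, fun i => by
    rw [← iteratedDeriv_succ']
    exact f.2.2 (i + 1)⟩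
  map_add' f g := ext fun x => deriv_add
    ((f.2.1.differentiable (by simp)).differentiableAt)
    ((g.2.1.differentiable (by simp)).differentiableAt)
  map_smul' c f := ext fun x => deriv_const_smul c
    ((f.2.1.differentiable (by simp)).differentiableAt)

theorem seminorm_derivLM_le (m : ℕ) (f : DL1) : seminorm m (derivLM f) ≤ seminorm (m + 1) f := by
  rw [seminorm_apply, seminorm_apply, Finset.sum_range_succ' _ (m + 1)]
  refine le_add_of_le_of_nonneg (Finset.sum_le_sum fun i _ => ?_)
    (integral_nonneg fun x => norm_nonneg _)
  rw [iteratedDeriv_succ']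
  rfl

/-- Differentiation on `𝒟_{L¹}`, as a continuous linear map. -/
noncomputable def derivCLM : DL1 →L[ℂ] DL1 where
  toLinearMap := derivLM
  cont := withSeminorms.continuous_of_isBounded withSeminorms derivLM fun m =>
    ⟨{m + 1}, 1, fun f => by simpa using seminorm_derivLM_le m f⟩

theorem seminorm_mono : Monotone seminorm := fun m n h f =>
  Finset.sum_le_sum_of_subset_of_nonneg (Finset.range_mono (by omega))
    fun _ _ _ => integral_nonneg fun _ => norm_nonneg _

/-- A continuous linear functional on `𝒟_{L¹}` is bounded by one of the norms. -/
theorem exists_norm_le (u : DL1 →L[ℂ] ℂ) :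
    ∃ (m : ℕ) (C : ℝ), 0 ≤ C ∧ ∀ f, ‖u f‖ ≤ C * seminorm m f := by
  obtain ⟨s, C, -, hC⟩ := Seminorm.bound_of_continuous withSeminorms
    ((normSeminorm ℂ ℂ).comp u.toLinearMap) (continuous_norm.comp u.continuous)
  -- The norms increase with their order, so the largest index in `s` dominates the finite supremum.
  refine ⟨s.sup id, C, C.2, fun f => (hC f).trans ?_⟩
  refine mul_le_mul_of_nonneg_left ?_ C.2
  have hs : s.sup (fun m : ℕ => seminorm m) ≤ seminorm (s.sup id) :=
    Finset.sup_le fun i hi => seminorm_mono (Finset.le_sup (f := id) hi)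
  exact hs f

/-- The norms of `𝒟_{L¹}` are invariant under reflections. -/
theorem seminorm_eq_of_comp_const_sub (m : ℕ) {f g : DL1} {x : ℝ} (h : ∀ y, f y = g (x - y)) :
    seminorm m f = seminorm m g := by
  rw [seminorm_apply, seminorm_apply]
  refine Finset.sum_congr rfl fun i _ => ?_
  have hfg : (f : ℝ → ℂ) = fun y => (g : ℝ → ℂ) (x - y) := funext h
  rw [hfg, iteratedDeriv_comp_const_sub]
  simp only [norm_smul, norm_pow, norm_neg, norm_one, one_pow, one_mul]
  exact integral_sub_left_eq_self (fun y => ‖iteratedDeriv i g y‖) volume x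

end DL1

/-- First order Taylor estimate in `L¹` for a smooth compactly supported function. -/
theorem exists_integral_norm_taylor_le {F : ℝ → ℂ} (hF : ContDiff ℝ 2 F)
    (hc : HasCompactSupport F) :
    ∃ C : ℝ, ∀ h : ℝ, |h| ≤ 1 → ∫ z, ‖F (z + h) - F z - h * deriv F z‖ ≤ C * |h| ^ 2 := by
  have hF1 : ContDiff ℝ 1 (deriv F) := (contDiff_succ_iff_deriv (n := 1).1 hF).2.2
  have hd : Differentiable ℝ F := hF.differentiable (by simp)
  have hd1 : Differentiable ℝ (deriv F) := hF1.differentiable (by simp)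
  obtain ⟨M, hM⟩ := hc.deriv.deriv.exists_bound_of_continuous (hF1.continuous_deriv le_rfl)
  obtain ⟨R, hR⟩ := hc.isBounded.subset_closedBall (0 : ℝ)
  have hM0 : 0 ≤ M := (norm_nonneg _).trans (hM 0)
  have hzero : ∀ z, R < |z| → F z = 0 ∧ deriv F z = 0 := fun z hz => by
    have hzn : z ∉ tsupport F := fun hmem => by
      have := hR hmem
      rw [mem_closedBall_zero_iff, Real.norm_eq_abs] at this
      linarith
    exact ⟨image_eq_zero_of_notMem_tsupport hzn,
      image_eq_zero_of_notMem_tsupport fun hmem => hzn (tsupport_deriv_subset hmem)⟩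
  have hlip : ∀ y z, ‖deriv F y - deriv F z‖ ≤ M * |y - z| := fun y z => by
    simpa using Convex.norm_image_sub_le_of_norm_deriv_le (fun w _ => hd1 w)
      (fun w _ => hM w) convex_univ (Set.mem_univ z) (Set.mem_univ y)
  -- Mean value inequality for `w ↦ F w - w F'(z)` between `z` and `z + h`, where its derivative is
  -- at most `M |h|`.
  have htaylor : ∀ h z : ℝ, ‖F (z + h) - F z - h * deriv F z‖ ≤ M * |h| ^ 2 := fun h z => by
    have hder : ∀ w, HasDerivAt (fun w : ℝ => F w - w * deriv F z) (deriv F w - deriv F z) w :=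
      fun w => ((hd w).hasDerivAt.sub
        ((hasDerivAt_id w).ofReal_comp.mul_const (deriv F z))).congr_deriv (by simp)
    have := Convex.norm_image_sub_le_of_norm_hasDerivWithin_le (C := M * |h|)
      (s := Set.uIcc z (z + h)) (fun w _ => (hder w).hasDerivWithinAt)
      (fun w hw => (hlip w z).trans (mul_le_mul_of_nonneg_left ?_ hM0))
      (convex_uIcc z (z + h)) Set.left_mem_uIcc Set.right_mem_uIcc
    · convert this using 1
      · congr 1
        push_cast
        ring
      · simp [sq, mul_assoc]
    · simpa using Set.abs_sub_left_of_mem_uIcc hw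
  -- For `|h| ≤ 1` the remainder vanishes outside the ball of radius `R + 1`, so the pointwise bound
  -- integrates.
  refine ⟨M * volume.real (Metric.closedBall (0 : ℝ) (R + 1)), fun h hh => ?_⟩
  have hsupp : ∀ z ∉ Metric.closedBall (0 : ℝ) (R + 1),
      ‖F (z + h) - F z - h * deriv F z‖ = 0 := fun z hz => by
    rw [mem_closedBall_zero_iff, Real.norm_eq_abs, not_le] at hz
    have hzh : R < |z + h| := by
      have := abs_sub_abs_le_abs_sub z (-h)
      rw [abs_neg, sub_neg_eq_add] at this
      linarith
    rw [(hzero _ hzh).1, (hzero z (by linarith)).1, (hzero z (by linarith)).2]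
    simp
  rw [← setIntegral_eq_integral_of_forall_compl_eq_zero hsupp]
  have := norm_setIntegral_le_of_norm_le_const (μ := volume)
    (measure_closedBall_lt_top (x := (0 : ℝ)) (r := R + 1))
    (fun z _ => (norm_norm (F (z + h) - F z - h * deriv F z)).le.trans (htaylor h z))
  calc _ ≤ _ := (Real.le_norm_self _).trans this
    _ = _ := by ring

/-! ### Regularizations of bounded distributions -/

namespace Distribution

/-- The functional `u` on `𝒟_{L¹}` restricts to the distribution `T`. -/
def Extends (u : DL1 →L[ℂ] ℂ) (T : 𝓓'((⊤ : Opens ℝ), ℂ)) : Prop :=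
  ∀ φ : 𝓓((⊤ : Opens ℝ), ℝ), T φ = u (DL1.ofTestFunction φ)

namespace Extends

variable {u v : DL1 →L[ℂ] ℂ} {S T : 𝓓'((⊤ : Opens ℝ), ℂ)}

theorem add (hS : Extends u S) (hT : Extends v T) : Extends (u + v) (S + T) := fun φ => by
  change S φ + T φ = u _ + v _
  rw [hS, hT]

theorem smul (hT : Extends u T) (c : ℂ) : Extends (c • u) (c • T) := fun φ => by
  change c • T φ = c • u _
  rw [hT]

theorem lineDeriv (hT : Extends u T) : Extends (-u.comp DL1.derivCLM) (∂_{(1 : ℝ)} T) := fun φ => by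
  rw [lineDerivOp_apply_apply, map_neg, hT]
  change -u _ = -u _
  congr 2
  refine DL1.ext fun x => ?_
  have hφ : DifferentiableAt ℝ φ x := φ.contDiff.differentiable (by simp) x
  change ((TestFunction.lineDerivCLM ℝ (1 : ℝ) φ : 𝓓((⊤ : Opens ℝ), ℝ)) x : ℂ) =
    deriv (fun x => (φ x : ℂ)) x
  rw [TestFunction.lineDerivCLM_apply_of_le (by simp), hφ.lineDeriv_eq_fderiv,
    fderiv_apply_one_eq_deriv, hφ.hasDerivAt.ofReal_comp.deriv]

theorem pairing_eq (hT : Extends u T) (φ : 𝓓((⊤ : Opens ℝ), ℂ)) :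
    pairing T φ = u (DL1.ofComplexTestFunction φ) := by
  rw [pairing, hT, hT, ← smul_eq_mul, ← map_smul, ← map_add]
  congr 1
  refine DL1.ext fun x => ?_
  change ((φ x).re : ℂ) + Complex.I * ((φ x).im : ℂ) = φ x
  rw [mul_comm, Complex.re_add_im]

theorem conv_eq (hT : Extends u T) (φ : 𝓓((⊤ : Opens ℝ), ℂ)) (x : ℝ) :
    conv T φ x = u (DL1.ofComplexTestFunction (reflectTranslate φ x)) :=
  hT.pairing_eq _

end Extends

namespace IsBoundedDistribution

variable {S T : 𝓓'((⊤ : Opens ℝ), ℂ)}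

theorem add (hS : IsBoundedDistribution S) (hT : IsBoundedDistribution T) :
    IsBoundedDistribution (S + T) :=
  let ⟨_, hu⟩ := hS
  let ⟨_, hv⟩ := hT
  ⟨_, Extends.add hu hv⟩

theorem smul (hT : IsBoundedDistribution T) (c : ℂ) : IsBoundedDistribution (c • T) :=
  let ⟨_, hu⟩ := hT
  ⟨_, Extends.smul hu c⟩

theorem lineDeriv (hT : IsBoundedDistribution T) : IsBoundedDistribution (∂_{(1 : ℝ)} T) :=
  let ⟨_, hu⟩ := hT
  ⟨_, Extends.lineDeriv hu⟩

/-- The regularizations of a bounded distribution are bounded functions. -/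
theorem exists_norm_conv_le (hT : IsBoundedDistribution T) (φ : 𝓓((⊤ : Opens ℝ), ℂ)) :
    ∃ C, ∀ x, ‖conv T φ x‖ ≤ C := by
  obtain ⟨u, hu⟩ := hT
  obtain ⟨m, C, -, hC⟩ := DL1.exists_norm_le u
  refine ⟨C * DL1.seminorm m (DL1.ofComplexTestFunction φ), fun x => ?_⟩
  rw [Extends.conv_eq hu, ← DL1.seminorm_eq_of_comp_const_sub (x := x)
    (f := DL1.ofComplexTestFunction (reflectTranslate φ x)) m fun _ => rfl]
  exact hC _

/-- The regularizations of a bounded distribution are differentiable, with derivative the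
regularization of the derivative. -/
theorem hasDerivAt_conv (hT : IsBoundedDistribution T) (φ : 𝓓((⊤ : Opens ℝ), ℂ)) (x : ℝ) :
    HasDerivAt (conv T φ) (conv (∂_{(1 : ℝ)} T) φ x) x := by
  obtain ⟨u, hu⟩ := hT
  obtain ⟨m, C, hC0, hC⟩ := DL1.exists_norm_le u
  have hsmooth : ∀ i : ℕ, ContDiff ℝ 2 (iteratedDeriv i φ) := fun i => by
    rw [iteratedDeriv_eq_iterate]
    exact (φ.contDiff.iterate_deriv i).of_le (WithTop.coe_le_coe.2 le_top)
  have hcpt : ∀ i : ℕ, HasCompactSupport (iteratedDeriv i φ) := fun i => by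
    induction i with
    | zero => simpa using φ.hasCompactSupport
    | succ n ih => rw [iteratedDeriv_succ]; exact ih.deriv
  choose K hK using fun i => exists_integral_norm_taylor_le (hsmooth i) (hcpt i)
  set P : ℝ → DL1 := fun y => DL1.ofComplexTestFunction (reflectTranslate φ y)
  have hPd : ∀ y, DL1.derivCLM (P x) y = -deriv φ (x - y) := fun y =>
    deriv_comp_const_sub (f := φ) x y
  have key : ∀ h : ℝ, |h| ≤ 1 →
      ‖conv T φ (x + h) - conv T φ x - h • conv (∂_{(1 : ℝ)} T) φ x‖ ≤
        (C * ∑ i ∈ Finset.range (m + 1), K i) * |h| ^ 2 := fun h hh => by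
    rw [Extends.conv_eq hu, Extends.conv_eq hu, (Extends.lineDeriv hu).conv_eq]
    -- The plus sign is right: differentiating `y ↦ φ (x - y)` gives `-φ'(x - y)`, so `R` is the
    -- reflected Taylor remainder of `φ`.
    set R : DL1 := P (x + h) - P x + (h : ℂ) • DL1.derivCLM (P x) with hR
    have huR : u (P (x + h)) - u (P x) - h • (-u.comp DL1.derivCLM) (P x) = u R := by
      rw [hR, map_add, map_sub, map_smul]
      simp [sub_neg_eq_add]
    rw [huR]
    refine (hC R).trans ?_
    rw [mul_assoc]
    refine mul_le_mul_of_nonneg_left ?_ hC0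
    rw [DL1.seminorm_apply, Finset.sum_mul]
    refine Finset.sum_le_sum fun i _ => ?_
    set G : ℝ → ℂ := fun z => φ (z + h) - φ z - h * deriv φ z with hG
    have hRG : (R : ℝ → ℂ) = fun y => G (x - y) := funext fun y => by
      change φ (x + h - y) - φ (x - y) + h * DL1.derivCLM (P x) y = _
      rw [hPd, hG, add_sub_right_comm, mul_neg, ← sub_eq_add_neg]
    -- Each derivative of the remainder is the remainder of that derivative, so the `L¹` Taylor
    -- estimate applies at every order up to `m`.
    have hGi : iteratedDeriv i G = fun z => iteratedDeriv i φ (z + h) - iteratedDeriv i φ z -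
        h * deriv (iteratedDeriv i φ) z := funext fun z => by
      have h1 : ContDiff ℝ i φ := φ.contDiff.of_le (mod_cast le_top)
      have h2 : ContDiff ℝ i (deriv φ) :=
        (contDiff_infty_iff_deriv.1 φ.contDiff).2.of_le (mod_cast le_top)
      have h3 : ContDiff ℝ i fun z => φ (z + h) := h1.comp (contDiff_id.add contDiff_const)
      rw [hG, iteratedDeriv_fun_sub (h3.sub h1).contDiffAt (contDiff_const.mul h2).contDiffAt,
        iteratedDeriv_fun_sub h3.contDiffAt h1.contDiffAt, iteratedDeriv_comp_add_const,
        iteratedDeriv_const_mul_field, ← iteratedDeriv_succ', iteratedDeriv_succ]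
    rw [hRG, iteratedDeriv_comp_const_sub]
    simp only [norm_smul, norm_pow, norm_neg, norm_one, one_pow, one_mul]
    rw [integral_sub_left_eq_self (fun y => ‖iteratedDeriv i G y‖) volume x, hGi]
    exact hK i h hh
  rw [hasDerivAt_iff_isLittleO_nhds_zero]
  refine Asymptotics.IsBigO.trans_isLittleO (g := fun h : ℝ => h ^ 2) ?_
    (by simpa using Asymptotics.isLittleO_pow_pow (𝕜 := ℝ) one_lt_two)
  refine Asymptotics.IsBigO.of_bound (C * ∑ i ∈ Finset.range (m + 1), K i) ?_
  filter_upwards [Metric.closedBall_mem_nhds (0 : ℝ) one_pos] with h hh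
  rw [mem_closedBall_zero_iff, Real.norm_eq_abs] at hh
  simpa only [norm_pow, Real.norm_eq_abs] using key h hh

end IsBoundedDistribution

section conv

variable (S T : 𝓓'((⊤ : Opens ℝ), ℂ)) (φ : 𝓓((⊤ : Opens ℝ), ℂ)) (x : ℝ)

theorem conv_add : conv (S + T) φ x = conv S φ x + conv T φ x := by
  change (S _ + T _) + Complex.I * (S _ + T _) = (S _ + Complex.I * S _) + (T _ + Complex.I * T _)
  ring

theorem conv_smul (c : ℂ) : conv (c • T) φ x = c * conv T φ x := by
  change c * T _ + Complex.I * (c * T _) = c * (T _ + Complex.I * T _)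
  ring

end conv

/-! ### Factorization of the differential operator -/

/-- The derivative of distributions as a `ℂ`-linear endomorphism. -/
noncomputable def derivEnd : Module.End ℂ 𝓓'((⊤ : Opens ℝ), ℂ) where
  toFun T := ∂_{(1 : ℝ)} T
  map_add' := LineDeriv.lineDerivOp_add 1
  map_smul' c T := by
    refine ContinuousLinearMap.ext fun φ => ?_
    change -(c • T _) = c • -(T _)
    rw [smul_neg]

/-- Turns factorizations of the polynomial into compositions of operators. -/
theorem diffOp_eq_aeval (p : ℕ) (a : ℕ → ℂ) (T : 𝓓'((⊤ : Opens ℝ), ℂ)) :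
    diffOp p a T = Polynomial.aeval derivEnd
      (∑ i ∈ Finset.range (p + 1), Polynomial.C (a i) * Polynomial.X ^ i) T := by
  rw [diffOp, map_sum, LinearMap.sum_apply]
  refine Finset.sum_congr rfl fun i _ => ?_
  rw [map_mul, Polynomial.aeval_C, map_pow, Polynomial.aeval_X, Module.End.mul_apply,
    Module.algebraMap_end_apply, Module.End.pow_apply]
  rfl

theorem IsAlmostAutomorphicDistribution.smul {T : 𝓓'((⊤ : Opens ℝ), ℂ)}
    (hT : IsAlmostAutomorphicDistribution T) (c : ℂ) :
    IsAlmostAutomorphicDistribution (c • T) := by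
  refine ⟨hT.1.smul c, fun φ => ?_⟩
  rw [show conv (c • T) φ = fun x => c * conv T φ x from funext fun x => conv_smul T φ x c]
  exact (hT.2 φ).const_mul c

/-- A bounded distribution `T` is almost automorphic if `T' - z T` is, for some `z` off the imaginary
axis. -/
theorem IsBoundedDistribution.isAlmostAutomorphic_of_derivEnd_sub
    {T : 𝓓'((⊤ : Opens ℝ), ℂ)} (hT : IsBoundedDistribution T) {z : ℂ} (hz : z.re ≠ 0)
    (h : IsAlmostAutomorphicDistribution (derivEnd T + (-z) • T)) :
    IsAlmostAutomorphicDistribution T := by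
  refine ⟨hT, fun φ => ?_⟩
  obtain ⟨B, hB⟩ := hT.exists_norm_conv_le φ
  obtain ⟨C, hC⟩ := h.1.exists_norm_conv_le φ
  refine IsAlmostAutomorphic.of_hasDerivAt hz (fun x => ?_) hB (h.2 φ) hC
  refine (hT.hasDerivAt_conv φ x).congr_deriv ?_
  rw [conv_add, conv_smul]
  change _ = _ + (conv (∂_{(1 : ℝ)} T) φ x + _)
  ring

open Polynomial in
/-- A bounded distribution `T` is almost automorphic if `P(d/dx) T` is, for some polynomial `P`
without purely imaginary roots. -/
theorem IsBoundedDistribution.isAlmostAutomorphic_of_aeval (P : ℂ[X])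
    (hP : ∀ z : ℂ, P.eval z = 0 → z.re ≠ 0) {T : 𝓓'((⊤ : Opens ℝ), ℂ)}
    (hT : IsBoundedDistribution T)
    (h : IsAlmostAutomorphicDistribution (aeval derivEnd P T)) :
    IsAlmostAutomorphicDistribution T := by
  induction hn : P.natDegree generalizing P T with
  | zero =>
    obtain ⟨c, rfl⟩ := natDegree_eq_zero.1 hn
    -- The zero polynomial would have the root `0`, which lies on the imaginary axis.
    have hc : c ≠ 0 := fun hc => hP 0 (by simp [hc]) rfl
    rw [aeval_C, Module.algebraMap_end_apply] at h
    simpa only [inv_smul_smul₀ hc] using h.smul c⁻¹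
  | succ n ih =>
    obtain ⟨z, hz⟩ := IsAlgClosed.exists_root P fun h0 => by
      have := natDegree_eq_zero_iff_degree_le_zero.2 h0.le
      omega
    obtain ⟨Q, rfl⟩ := dvd_iff_isRoot.2 hz
    have hQ : Q ≠ 0 := by
      rintro rfl
      simp at hn
    rw [natDegree_mul (X_sub_C_ne_zero z) hQ, natDegree_X_sub_C] at hn
    -- The induction hypothesis is used for `Q` and the distribution `T' - zT`, which is again
    -- bounded.
    refine hT.isAlmostAutomorphic_of_derivEnd_sub (hP z hz) (ih Q
      (fun w hw => hP w (by rw [eval_mul, hw, mul_zero])) (hT.lineDeriv.add (hT.smul (-z))) ?_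
      (by omega))
    -- Commuting the factors makes `d/dx - z` act on `T` before `Q(d/dx)`.
    rw [mul_comm, map_mul, Module.End.mul_apply, map_sub, aeval_X, aeval_C, LinearMap.sub_apply,
      Module.algebraMap_end_apply, sub_eq_add_neg, ← neg_smul] at h
    exact h

end Distribution

theorem mainTheorem11 (p : ℕ) (a : ℕ → ℂ)
    (ha : ∀ z : ℂ, ∑ i ∈ Finset.range (p + 1), a i * z ^ i = 0 → z.re ≠ 0)
    (S T : 𝓓'((⊤ : Opens ℝ), ℂ))
    (hS : Distribution.IsAlmostAutomorphicDistribution S)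
    (hT : Distribution.IsBoundedDistribution T)
    (hLT : Distribution.diffOp p a T = S) :
    Distribution.IsAlmostAutomorphicDistribution T := by
  refine hT.isAlmostAutomorphic_of_aeval _ (fun z hz => ha z ?_)
    ((Distribution.diffOp_eq_aeval p a T).symm.trans hLT ▸ hS)
  simpa [Polynomial.eval_finsetSum] using hz
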